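/- Let $n$ be a nonnegative integer, let $z_1,\dots,z_n\in\mathbb{R}^3$ be pairwise distinct points and let $\alpha_1,\dots,\alpha_n\in\mathbb{R}$. A function $\psi:\mathbb{R}^3\setminus\{z_1,\dots,z_n\}\to\mathbb{C}$ is said to satisfy the zero-energy Schrödinger equation $-\Delta\psi+v\psi=0$ with the multipoint potential $v=\sum_{j=1}^n v_{z_j,\alpha_j}$ if $\psi$ is $C^2$ with $-\Delta\psi=0$ on $\mathbb{R}^3\setminus\{z_1,\dots,z_n\}$, and for every $j$ there are $\psi_{j,-1},\psi_{j,0}\in\mathbb{C}$ with $$\psi(x)=\frac{\psi_{j,-1}}{|x-z_j|}+\psi_{j,0}+O(|x-z_j|)\quad (x\to z_j),\qquad \psi_{j,0}=4\pi\alpha_j\,\psi_{j,-1}.$$ Let $A$ be the $n\times n$ matrix with $A_{j,j}=\alpha_j$ and $A_{j,j'}=-\dfrac{1}{4\pi|z_j-z_{j'}|}$ for $j\neq j'$. Then this equation has a nonzero solution $\psi\in L^2(\mathbb{R}^3)$ if and only if there is a nonzero vector $q=(q_1,\dots,q_n)\in\mathbb{C}^n$ such that $$A q=0\qquad\text{and}\qquad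 \sum_{j=1}^n q_j=0 .$$ Moreover, the formula $$\psi(x)=-\frac{1}{4\pi}\sum_{j=1}^n \frac{q_j}{|x-z_j|},\qquad x\in\mathbb{R}^3\setminus\{z_1,\dots,z_n\},$$ defines a one-to-one correspondence between the nonzero vectors $q$ with these two properties and the nonzero solutions $\psi\in L^2(\mathbb{R}^3)$: each such $q$ gives such a solution, and each such solution is given by exactly one such $q$. -/

import Mathlib

open MeasureTheory Filter Topology Asymptotics

noncomputable section

namespace PointScatterer

/-- Euclidean three-space. -/
abbrev R3 : Type := EuclideanSpace ℝ (Fin 3)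

/-- `ψ` satisfies the stationary Schrödinger equation `-Δψ + vψ = Eψ` on `ℝ³`, where `v` is the
multipoint potential with scatterers at `z j` and internal parameters `α j`.
The values of `ψ` at the points `z j` themselves play no role. -/
structure IsSolution {n : ℕ} (z : Fin n → R3) (α : Fin n → ℝ) (E : ℝ) (ψ : R3 → ℂ) : Prop where
  /-- `ψ` is `C²` away from the scatterers. -/
  contDiffOn : ContDiffOn ℝ 2 ψ (Set.range z)ᶜ
  /-- `-Δψ = Eψ` away from the scatterers. -/
  equation : ∀ x ∉ Set.range z, -(Laplacian.laplacian ψ x) = (E : ℂ) * ψ x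
  /-- `ψ(x) = a / |x - z_j| + b + O(|x - z_j|)` as `x → z_j`, with `b = 4π α_j a`. -/
  expansion : ∀ j, ∃ a b : ℂ,
    (fun x : R3 => ψ x - (a / (‖x - z j‖ : ℂ) + b)) =O[𝓝[≠] (z j)] (fun x : R3 => ‖x - z j‖) ∧
    b = 4 * (Real.pi : ℂ) * (α j : ℂ) * a

/-- `√E`, the principal complex root, so that `√E ≥ 0` for `E ≥ 0`. -/
def sqrtE (E : ℝ) : ℂ := (E : ℂ) ^ (1 / 2 : ℂ)

/-- The Green function `G⁺(r, E) = -exp(i √E r) / (4π r)`. -/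
def greenPlus (r E : ℝ) : ℂ :=
  -(Complex.exp (Complex.I * sqrtE E * (r : ℂ)) / (4 * (Real.pi : ℂ) * (r : ℂ)))

/-- The `n × n` matrix with diagonal entries `α_j - i √E / (4π)` and off-diagonal entries
`G⁺(|z_j - z_{j'}|, E)`. -/
def scattererMatrix {n : ℕ} (z : Fin n → R3) (α : Fin n → ℝ) (E : ℝ) :
    Matrix (Fin n) (Fin n) ℂ :=
  Matrix.of fun j j' =>
    if j' = j then (α j : ℂ) - Complex.I * sqrtE E / (4 * (Real.pi : ℂ))
    else greenPlus ‖z j - z j'‖ E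

/-- `ψ` is a zero-energy bound state: a solution at energy `E = 0` that lies in `L²(ℝ³)` and is
nonzero there. -/
def IsZeroEnergyBoundState {n : ℕ} (z : Fin n → R3) (α : Fin n → ℝ) (ψ : R3 → ℂ) : Prop :=
  IsSolution z α 0 ψ ∧ MemLp ψ 2 (volume : Measure R3) ∧ ¬ ψ =ᵐ[(volume : Measure R3)] 0

/-- `q` is nonzero, `A q = 0` for `E = 0`, and the entries of `q` sum to zero. -/
def IsNeutralNullVector {n : ℕ} (z : Fin n → R3) (α : Fin n → ℝ) (q : Fin n → ℂ) : Prop :=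
  q ≠ 0 ∧ (scattererMatrix z α 0).mulVec q = 0 ∧ ∑ j, q j = 0

/-- `ψ(x) = -(1 / 4π) ∑ q_j / |x - z_j|`. -/
def coulombSum {n : ℕ} (z : Fin n → R3) (q : Fin n → ℂ) (x : R3) : ℂ :=
  -(1 / (4 * (Real.pi : ℂ))) * ∑ j, q j * (1 / (‖x - z j‖ : ℂ))

end PointScatterer

end

/-! A Coulomb sum is harmonic off the points `z j`. Near `z j` it has pole coefficient `-q j /
(4π)`, and its constant term is the value there of the remaining terms. Row `j` of `A q = 0` is
therefore exactly the point condition `b = 4π α_j a` (`scattererMatrix_zero_mulVec`). At infinity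
the sum is `-(∑ q j) / (4π |x|) + O(|x|⁻²)`; in dimension three the second term is square integrable
and the first is not, unless the total charge vanishes.

Conversely, given an L² solution, let `q j` be `-4π` times its pole coefficient at `z j`.
Subtracting the Coulomb sum leaves a harmonic function bounded near each `z j`. An L² harmonic
function is `o(1/|x|)` at infinity, by a weighted mean value property
(`tendsto_norm_mul_norm_of_memLp`), so the difference tends to zero. A maximum principle with
removable singularities (`eq_zero_of_harmonicAt_compl_range`) makes it vanish. Comparing constant
terms at `z j` yields `A q = 0`, and the `o(1/|x|)` decay yields `∑ q j = 0`. Uniqueness of `q`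
holds because the pole coefficients determine it. -/

noncomputable section

namespace PointScatterer

/-! ### Second derivatives along lines and explicit Laplacians -/

section LineDerivatives

variable {E F : Type*} [NormedAddCommGroup E] [NormedSpace ℝ E] [NormedAddCommGroup F]
  [NormedSpace ℝ F]

theorem hasDerivAt_comp_add_smul {f : E → F} {x e : E} {t : ℝ}
    (hf : DifferentiableAt ℝ f (x + t • e)) :
    HasDerivAt (fun s : ℝ => f (x + s • e)) (fderiv ℝ f (x + t • e) e) t := by
  have h : HasDerivAt (fun s : ℝ => x + s • e) e t := by
    simpa using ((hasDerivAt_id t).smul_const e).const_add x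
  exact hf.hasFDerivAt.comp_hasDerivAt t h

theorem deriv_comp_add_smul_eventuallyEq {f : E → F} {x : E} (hf : ContDiffAt ℝ 2 f x) (e : E) :
    deriv (fun s : ℝ => f (x + s • e)) =ᶠ[𝓝 0] fun s => fderiv ℝ f (x + s • e) e := by
  have hc : Tendsto (fun s : ℝ => x + s • e) (𝓝 0) (𝓝 x) := by
    have : Continuous (fun s : ℝ => x + s • e) := by fun_prop
    simpa using this.tendsto 0
  have hev : ∀ᶠ y in 𝓝 x, DifferentiableAt ℝ f y :=
    (hf.eventually (by simp)).mono fun y hy => hy.differentiableAt (by simp)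
  filter_upwards [hc.eventually hev] with s hs
  exact (hasDerivAt_comp_add_smul hs).deriv

theorem deriv_deriv_comp_add_smul {f : E → F} {x : E} (hf : ContDiffAt ℝ 2 f x) (e : E) :
    deriv (deriv (fun s : ℝ => f (x + s • e))) 0 = iteratedFDeriv ℝ 2 f x ![e, e] := by
  rw [(deriv_comp_add_smul_eventuallyEq hf e).deriv_eq]
  have hd : DifferentiableAt ℝ (fderiv ℝ f) (x + (0 : ℝ) • e) := by
    simpa using (hf.fderiv_right (m := 1) (by norm_num)).differentiableAt (by simp)
  have := ((hasDerivAt_comp_add_smul hd).clm_apply (hasDerivAt_const (0 : ℝ) e)).deriv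
  simpa [iteratedFDeriv_two_apply] using this

/-- A positive second derivative would make the restriction to the line a local minimum as well as a
local maximum, hence locally constant, and then its second derivative would be zero. -/
theorem iteratedFDeriv_two_nonpos_of_isLocalMax {f : E → ℝ} {x : E} (hf : ContDiffAt ℝ 2 f x)
    (hx : IsLocalMax f x) (e : E) : iteratedFDeriv ℝ 2 f x ![e, e] ≤ 0 := by
  rw [← deriv_deriv_comp_add_smul hf e]
  by_contra! hpos
  have hc : ContinuousAt (fun s : ℝ => x + s • e) 0 := by fun_prop
  have hmax : IsLocalMax (fun s : ℝ => f (x + s • e)) 0 := by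
    have : Tendsto (fun s : ℝ => x + s • e) (𝓝 0) (𝓝 x) := by simpa using hc.tendsto
    have := this.eventually hx
    simpa [IsLocalMax, IsMaxFilter] using this
  have hcont : ContinuousAt (fun s : ℝ => f (x + s • e)) 0 := by
    refine ContinuousAt.comp (g := f) ?_ hc
    simpa using hf.continuousAt
  have hmin := isLocalMin_of_deriv_deriv_pos hpos hmax.deriv_eq_zero hcont
  have hconst : (fun s : ℝ => f (x + s • e)) =ᶠ[𝓝 0] fun _ => f (x + (0 : ℝ) • e) := by
    filter_upwards [hmax, hmin] with s h1 h2 using le_antisymm h1 h2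
  have h0 : deriv (deriv (fun s : ℝ => f (x + s • e))) 0 = 0 := by
    rw [hconst.deriv.deriv_eq]
    simp
  exact hpos.ne' h0

end LineDerivatives

theorem laplacian_nonpos_of_isLocalMax {f : R3 → ℝ} {x : R3} (hf : ContDiffAt ℝ 2 f x)
    (hx : IsLocalMax f x) : Laplacian.laplacian f x ≤ 0 := by
  rw [InnerProductSpace.laplacian_eq_iteratedFDeriv_stdOrthonormalBasis]
  exact Finset.sum_nonpos fun i _ => iteratedFDeriv_two_nonpos_of_isLocalMax hf hx _

theorem norm_add_smul_sq {x e : R3} (he : ‖e‖ = 1) (t : ℝ) :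
    ‖x + t • e‖ ^ 2 = ‖x‖ ^ 2 + 2 * t * inner ℝ x e + t ^ 2 := by
  rw [norm_add_sq_real, norm_smul, inner_smul_right, he]
  simp [mul_assoc]

theorem laplacian_norm_sq (x : R3) : Laplacian.laplacian (fun y : R3 => ‖y‖ ^ 2) x = 6 := by
  have key : ∀ e : R3, ‖e‖ = 1 →
      iteratedFDeriv ℝ 2 (fun y : R3 => ‖y‖ ^ 2) x ![e, e] = 2 := by
    intro e he
    rw [← deriv_deriv_comp_add_smul (contDiff_norm_sq ℝ).contDiffAt e]
    simp only [norm_add_smul_sq he]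
    have h1 : deriv (fun t : ℝ => ‖x‖ ^ 2 + 2 * t * inner ℝ x e + t ^ 2) =
        fun t => 2 * inner ℝ x e + 2 * t := by
      ext t
      have h := ((((hasDerivAt_id t).const_mul 2).mul_const (inner ℝ x e)).const_add
        (‖x‖ ^ 2)).add (hasDerivAt_pow 2 t)
      refine (h.congr_deriv ?_).deriv
      simp
    rw [h1]
    refine ((((hasDerivAt_id (0 : ℝ)).const_mul 2).const_add (2 * inner ℝ x e)).congr_deriv
      ?_).deriv
    simp
  rw [InnerProductSpace.laplacian_eq_iteratedFDeriv_orthonormalBasis _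
    (EuclideanSpace.basisFun (Fin 3) ℝ)]
  simp only
  rw [Finset.sum_congr rfl fun i _ => key _ ((EuclideanSpace.basisFun (Fin 3) ℝ).orthonormal.1 i)]
  norm_num

theorem contDiffAt_inv_norm {x : R3} (hx : x ≠ 0) : ContDiffAt ℝ 2 (fun y : R3 => ‖y‖⁻¹) x :=
  (contDiffAt_norm ℝ hx).inv (norm_ne_zero_iff.2 hx)

theorem iteratedFDeriv_two_inv_norm {x e : R3} (hx : x ≠ 0) (he : ‖e‖ = 1) :
    iteratedFDeriv ℝ 2 (fun y : R3 => ‖y‖⁻¹) x ![e, e] =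
      -(‖x‖ ^ 3)⁻¹ + 3 * (inner ℝ x e) ^ 2 * (‖x‖ ^ 5)⁻¹ := by
  have hnorm : ∀ t : ℝ, x + t • e ≠ 0 →
      HasDerivAt (fun s : ℝ => ‖x + s • e‖) ((inner ℝ x e + t) * ‖x + t • e‖⁻¹) t := by
    intro t ht
    have hpos : 0 < ‖x + t • e‖ := norm_pos_iff.2 ht
    have hd : DifferentiableAt ℝ (fun s : ℝ => ‖x + s • e‖) t :=
      DifferentiableAt.norm ℝ (by fun_prop) ht
    have h1 := hd.hasDerivAt.pow 2
    have h2 := (((((hasDerivAt_id t).const_mul 2).mul_const (inner ℝ x e)).const_add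
        (‖x‖ ^ 2)).add (hasDerivAt_pow 2 t))
    have h3 : (fun s : ℝ => ‖x + s • e‖) ^ 2 =
        (fun t : ℝ => ‖x‖ ^ 2 + 2 * id t * inner ℝ x e) + fun t => t ^ 2 := by
      ext t
      simpa using norm_add_smul_sq he t
    rw [h3] at h1
    have h4 := h1.unique h2
    refine hd.hasDerivAt.congr_deriv ?_
    simp at h4
    field_simp
    linarith
  have hinv : ∀ t : ℝ, x + t • e ≠ 0 →
      HasDerivAt (fun s : ℝ => ‖x + s • e‖⁻¹) (-(inner ℝ x e + t) * (‖x + t • e‖ ^ 3)⁻¹) t := by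
    intro t ht
    have hpos : 0 < ‖x + t • e‖ := norm_pos_iff.2 ht
    refine ((hnorm t ht).inv hpos.ne').congr_deriv ?_
    field_simp
  have hne : ∀ᶠ t : ℝ in 𝓝 0, x + t • e ≠ 0 := by
    have hc : ContinuousAt (fun s : ℝ => x + s • e) 0 := by fun_prop
    exact hc.eventually_ne (by simpa using hx)
  rw [← deriv_deriv_comp_add_smul (contDiffAt_inv_norm hx) e]
  have hev : deriv (fun s : ℝ => ‖x + s • e‖⁻¹) =ᶠ[𝓝 0]
      fun t => -(inner ℝ x e + t) * (‖x + t • e‖ ^ 3)⁻¹ := by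
    filter_upwards [hne] with t ht using (hinv t ht).deriv
  rw [hev.deriv_eq]
  have hpos : 0 < ‖x‖ := norm_pos_iff.2 hx
  have hx0 : x + (0 : ℝ) • e ≠ 0 := by simpa using hx
  have hnum : HasDerivAt (fun t : ℝ => -(inner ℝ x e + t)) (-1) 0 :=
    ((hasDerivAt_id (0 : ℝ)).const_add (inner ℝ x e)).neg
  have hden := ((hnorm 0 hx0).pow 3).inv (pow_ne_zero 3 (norm_ne_zero_iff.2 hx0))
  refine ((hnum.mul hden).congr_deriv ?_).deriv
  simp
  field_simp

/-- Summing the second derivatives over an orthonormal basis gives `-3 r⁻³ + 3 r² r⁻⁵`, which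
cancels because the dimension is three. -/
theorem laplacian_inv_norm {x : R3} (hx : x ≠ 0) :
    Laplacian.laplacian (fun y : R3 => ‖y‖⁻¹) x = 0 := by
  have hpos : 0 < ‖x‖ := norm_pos_iff.2 hx
  rw [InnerProductSpace.laplacian_eq_iteratedFDeriv_orthonormalBasis _
    (EuclideanSpace.basisFun (Fin 3) ℝ)]
  simp only
  rw [Finset.sum_congr rfl fun i _ => iteratedFDeriv_two_inv_norm hx
    ((EuclideanSpace.basisFun (Fin 3) ℝ).orthonormal.1 i)]
  rw [Finset.sum_add_distrib, ← Finset.sum_mul, ← Finset.mul_sum]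
  have : ∑ i, (inner ℝ x (EuclideanSpace.basisFun (Fin 3) ℝ i)) ^ 2 = ‖x‖ ^ 2 := by
    simpa using (EuclideanSpace.basisFun (Fin 3) ℝ).sum_sq_norm_inner_left x
  rw [this]
  simp
  field_simp
  norm_num

theorem laplacian_comp_sub {F : Type*} [NormedAddCommGroup F] [NormedSpace ℝ F] (f : R3 → F)
    (z x : R3) :
    Laplacian.laplacian (fun y => f (y - z)) x = Laplacian.laplacian f (x - z) := by
  simp only [InnerProductSpace.laplacian_eq_iteratedFDeriv_stdOrthonormalBasis,
    iteratedFDeriv_comp_sub]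

/-! ### A weighted mean value property -/

/-- The radial weight `max(0, 1 - |y|²)`. -/
def radialWeight (y : R3) : ℝ := max 0 (1 - ‖y‖ ^ 2)

theorem continuous_radialWeight : Continuous radialWeight := by
  unfold radialWeight
  fun_prop

theorem radialWeight_nonneg (y : R3) : 0 ≤ radialWeight y := le_max_left _ _

theorem radialWeight_le_one (y : R3) : radialWeight y ≤ 1 :=
  max_le zero_le_one (by nlinarith [sq_nonneg ‖y‖])

theorem radialWeight_eq_zero {y : R3} (hy : 1 ≤ ‖y‖) : radialWeight y = 0 :=
  max_eq_left (by nlinarith)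

theorem hasCompactSupport_radialWeight : HasCompactSupport radialWeight :=
  HasCompactSupport.intro (isCompact_closedBall (0 : R3) 1) fun y hy =>
    radialWeight_eq_zero (by simpa using (not_le.1 (by simpa using hy)).le)

theorem integrable_radialWeight : Integrable radialWeight :=
  continuous_radialWeight.integrable_of_hasCompactSupport hasCompactSupport_radialWeight

theorem integrable_radialWeight_smul {g : R3 → ℂ} (hg : Continuous g) :
    Integrable fun y => radialWeight y • g y :=
  (continuous_radialWeight.smul hg).integrable_of_hasCompactSupport
    hasCompactSupport_radialWeight.smul_right

theorem integrable_radialWeight_sq_smul {g : R3 → ℂ} (hg : Continuous g) :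
    Integrable fun y => radialWeight y ^ 2 • g y := by
  have h := integrable_radialWeight_smul (continuous_radialWeight.smul hg)
  refine h.congr (Eventually.of_forall fun y => ?_)
  simp only [Pi.smul_apply', smul_smul, sq]

theorem integral_radialWeight_pos : 0 < ∫ y, radialWeight y := by
  refine continuous_radialWeight.integral_pos_of_hasCompactSupport_nonneg_nonzero
    hasCompactSupport_radialWeight radialWeight_nonneg (x := 0) ?_
  simp [radialWeight]

theorem hasDerivAt_max_zero_sq (t : ℝ) :
    HasDerivAt (fun s : ℝ => max 0 s ^ 2) (2 * max 0 t) t := by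
  rcases lt_trichotomy t 0 with ht | rfl | ht
  · have h : (fun s : ℝ => max 0 s ^ 2) =ᶠ[𝓝 t] fun _ => 0 := by
      filter_upwards [eventually_lt_nhds ht] with s hs
      simp [max_eq_left hs.le]
    rw [max_eq_left ht.le, mul_zero]
    exact (hasDerivAt_const t (0 : ℝ)).congr_of_eventuallyEq h
  · rw [max_self, mul_zero, hasDerivAt_iff_isLittleO_nhds_zero]
    have h : (fun s : ℝ => s ^ 2) =o[𝓝 0] fun s : ℝ => s := by
      simpa using isLittleO_pow_pow (𝕜 := ℝ) (m := 1) (n := 2) (by norm_num)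
    refine (IsBigO.of_bound 1 (Eventually.of_forall fun s => ?_)).trans_isLittleO h
    rcases le_total s 0 with hs | hs
    · simp [max_eq_left hs]
      positivity
    · simp [max_eq_right hs]
  · have h : (fun s : ℝ => max 0 s ^ 2) =ᶠ[𝓝 t] fun s => s ^ 2 := by
      filter_upwards [eventually_gt_nhds ht] with s hs
      simp [max_eq_right hs.le]
    rw [max_eq_right ht.le]
    simpa using (hasDerivAt_pow 2 t).congr_of_eventuallyEq h

/-- The reason for this weight `w`: the field `w(y) y` is the gradient of `-w²/4`, so a radial
derivative integrated against `w` becomes a Laplacian integrated against `w²`. Squaring also removes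
the corner of `w` on the unit sphere. -/
theorem hasLineDerivAt_radialWeight_sq (y e : R3) :
    HasLineDerivAt ℝ (fun y => radialWeight y ^ 2) (-4 * (inner ℝ y e * radialWeight y)) y e := by
  have h1 : HasFDerivAt (fun y : R3 => 1 - ‖y‖ ^ 2) (-(2 • innerSL ℝ y)) y :=
    (hasStrictFDerivAt_norm_sq y).hasFDerivAt.const_sub 1
  have h2 := ((hasDerivAt_max_zero_sq (1 - ‖y‖ ^ 2)).comp_hasFDerivAt y h1).hasLineDerivAt e
  have h3 : ((2 * max 0 (1 - ‖y‖ ^ 2)) • -(2 • innerSL ℝ y)) e =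
      -4 * (inner ℝ y e * radialWeight y) := by
    simp [radialWeight]
    ring
  rw [h3] at h2
  exact h2

theorem integral_radialWeight_inner_smul {g g' : R3 → ℂ} {e : R3} (hg : Continuous g)
    (hg' : Continuous g') (h : ∀ y, HasLineDerivAt ℝ g (g' y) y e) :
    ∫ y, radialWeight y • (inner ℝ y e • g y) = (1 / 4 : ℝ) • ∫ y, radialWeight y ^ 2 • g' y := by
  have hi : Integrable fun y => radialWeight y • (inner ℝ y e • g y) :=
    integrable_radialWeight_smul (by fun_prop)
  have hparts := integral_bilinear_hasLineDerivAt_right_eq_neg_left_of_integrable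
    (μ := (volume : Measure R3)) (f := fun y => radialWeight y ^ 2)
    (f' := fun y => -4 * (inner ℝ y e * radialWeight y)) (g := g) (g' := g') (v := e)
    (B := ContinuousLinearMap.lsmul ℝ ℝ) ?_ ?_ ?_
    (fun y _ => hasLineDerivAt_radialWeight_sq y e) (fun y _ => h y)
  · simp only [ContinuousLinearMap.lsmul_apply] at hparts
    rw [hparts, ← integral_neg, ← integral_smul]
    congr 1
    ext1 y
    simp only [smul_smul, ← neg_smul]
    congr 1
    ring
  · refine (hi.smul (-4 : ℝ)).congr (Eventually.of_forall fun y => ?_)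
    simp only [ContinuousLinearMap.lsmul_apply, Pi.smul_apply, smul_smul]
    congr 1
    ring
  · exact integrable_radialWeight_sq_smul hg'
  · exact integrable_radialWeight_sq_smul hg

theorem hasDerivAt_integral_radialWeight {u : R3 → ℂ} (hu : ContDiff ℝ 2 u) (x : R3) (r : ℝ) :
    HasDerivAt (fun s : ℝ => ∫ y, radialWeight y • u (x + s • y))
      (∫ y, radialWeight y • fderiv ℝ u (x + r • y) y) r := by
  have hDu : Continuous (fderiv ℝ u) := hu.continuous_fderiv (by simp)
  have hcont : Continuous fun p : ℝ × R3 => ‖fderiv ℝ u (x + p.1 • p.2) p.2‖ := by fun_prop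
  -- The derivative need only be bounded for `y` in the unit ball, since the weight vanishes
  -- elsewhere.
  obtain ⟨C, hC⟩ := ((isCompact_closedBall r 1).prod
    (isCompact_closedBall (0 : R3) 1)).bddAbove_image hcont.continuousOn
  refine (hasDerivAt_integral_of_dominated_loc_of_deriv_le (Metric.ball_mem_nhds r one_pos)
    (F' := fun s y => radialWeight y • fderiv ℝ u (x + s • y) y)
    (bound := fun y => radialWeight y * C) ?_ ?_ ?_ ?_ ?_ ?_).2
  · have := hu.continuous
    exact Eventually.of_forall fun s =>
      (integrable_radialWeight_smul (by fun_prop)).aestronglyMeasurable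
  · have := hu.continuous
    exact integrable_radialWeight_smul (by fun_prop)
  · exact (integrable_radialWeight_smul (by fun_prop)).aestronglyMeasurable
  · refine Eventually.of_forall fun y s hs => ?_
    rw [norm_smul, Real.norm_of_nonneg (radialWeight_nonneg y)]
    rcases le_total 1 ‖y‖ with hy | hy
    · simp [radialWeight_eq_zero hy]
    · refine mul_le_mul_of_nonneg_left ?_ (radialWeight_nonneg y)
      exact hC ⟨(s, y), ⟨Metric.ball_subset_closedBall hs, by simpa using hy⟩, rfl⟩
  · exact integrable_radialWeight.mul_const C
  · refine Eventually.of_forall fun y s _ => ?_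
    have := hasDerivAt_comp_add_smul (x := x) (e := y) (t := s)
      (hu.differentiable (by simp) (x + s • y))
    exact this.const_smul (radialWeight y)

/-- The left side is the derivative in `r` of the weighted mean. Harmonicity kills the right side,
so the mean is constant in `r`. -/
theorem integral_radialWeight_fderiv {u : R3 → ℂ} (hu : ContDiff ℝ 2 u) (x : R3) (r : ℝ) :
    ∫ y, radialWeight y • fderiv ℝ u (x + r • y) y =
      (r / 4) • ∫ y, radialWeight y ^ 2 • Laplacian.laplacian u (x + r • y) := by
  have hDu1 : ContDiff ℝ 1 (fderiv ℝ u) := hu.fderiv_right (by norm_num)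
  have hDu : Continuous (fderiv ℝ u) := hDu1.continuous
  have hD2u : Continuous (fderiv ℝ (fderiv ℝ u)) := hDu1.continuous_fderiv (by simp)
  let b := EuclideanSpace.basisFun (Fin 3) ℝ
  have hsum : ∀ y, radialWeight y • fderiv ℝ u (x + r • y) y =
      ∑ i, radialWeight y • (inner ℝ y (b i) • fderiv ℝ u (x + r • y) (b i)) := by
    intro y
    rw [← Finset.smul_sum]
    congr 1
    have hy := congrArg (fderiv ℝ u (x + r • y)) (b.sum_repr' y)
    rw [map_sum] at hy
    simp only [map_smul] at hy
    rw [← hy]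
    simp only [real_inner_comm]
  have hlap : ∀ y, radialWeight y ^ 2 • Laplacian.laplacian u (x + r • y) =
      ∑ i, radialWeight y ^ 2 • fderiv ℝ (fderiv ℝ u) (x + r • y) (b i) (b i) := by
    intro y
    rw [InnerProductSpace.laplacian_eq_iteratedFDeriv_orthonormalBasis _ b, ← Finset.smul_sum]
    simp [iteratedFDeriv_two_apply]
  simp only [hsum, hlap]
  rw [integral_finsetSum _ fun i _ => integrable_radialWeight_smul (by fun_prop),
    integral_finsetSum _ fun i _ => integrable_radialWeight_sq_smul (by fun_prop),
    Finset.smul_sum]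
  refine Finset.sum_congr rfl fun i _ => ?_
  rw [integral_radialWeight_inner_smul (g := fun y => fderiv ℝ u (x + r • y) (b i))
    (g' := fun y => r • fderiv ℝ (fderiv ℝ u) (x + r • y) (b i) (b i))
    (by fun_prop) (by fun_prop)]
  · rw [← integral_smul, ← integral_smul]
    congr 1
    ext1 y
    simp only [smul_smul]
    congr 1
    ring
  · intro y
    have h1 : HasFDerivAt (fun y : R3 => x + r • y) (r • ContinuousLinearMap.id ℝ R3) y :=
      ((hasFDerivAt_id y).const_smul r).const_add x
    have h2 : HasFDerivAt (fderiv ℝ u) (fderiv ℝ (fderiv ℝ u) (x + r • y)) (x + r • y) :=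
      (hDu1.differentiable (by simp) _).hasFDerivAt
    have h3 := ((h2.comp y h1).clm_apply (hasFDerivAt_const (b i) y)).hasLineDerivAt (b i)
    simpa using h3

/-- Weighted mean value property of harmonic functions. -/
theorem integral_radialWeight_eq {u : R3 → ℂ} (hu : ContDiff ℝ 2 u) {x : R3} {r : ℝ} (hr : 0 ≤ r)
    (hharm : ∀ y ∈ Metric.ball x r, Laplacian.laplacian u y = 0) :
    ∫ y, radialWeight y • u (x + r • y) = (∫ y, radialWeight y) • u x := by
  have hd := hasDerivAt_integral_radialWeight hu x
  have hconst := constant_of_has_deriv_right_zero (a := 0) (b := r)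
    (f := fun s : ℝ => ∫ y, radialWeight y • u (x + s • y))
    (fun s _ => (hd s).continuousAt.continuousWithinAt) ?_ r ⟨hr, le_rfl⟩
  · rw [hconst]
    simp only [zero_smul, add_zero]
    exact integral_smul_const _ _
  · intro s hs
    have hzero : ∫ y, radialWeight y • fderiv ℝ u (x + s • y) y = 0 := by
      rw [integral_radialWeight_fderiv hu]
      refine smul_eq_zero_of_right _ ?_
      refine integral_eq_zero_of_ae (Eventually.of_forall fun y => ?_)
      rcases le_or_gt 1 ‖y‖ with hy | hy
      · simp [radialWeight_eq_zero hy]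
      · simp only [Pi.zero_apply]
        rw [hharm, smul_zero]
        rw [mem_ball_iff_norm, add_sub_cancel_left, norm_smul, Real.norm_of_nonneg hs.1]
        nlinarith [hs.1, hs.2, norm_nonneg y]
    exact hzero ▸ (hd s).hasDerivWithinAt

/-! ### Decay at infinity of square-integrable harmonic functions -/

/-- The mean value property combined with `t ≤ ε + t² / (4ε)`; the factor `r⁻³` is the Jacobian of
the rescaling. The free parameter `ε` takes the place of the Cauchy–Schwarz inequality. -/
theorem norm_mul_integral_radialWeight_le {ψ : R3 → ℂ} (hψ : MemLp ψ 2 volume) {x : R3} {r ε : ℝ}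
    (hr : 0 < r) (hε : 0 < ε) (hdiff : ContDiffOn ℝ 2 ψ (Metric.ball x (2 * r)))
    (hharm : ∀ y ∈ Metric.ball x (2 * r), Laplacian.laplacian ψ y = 0) :
    ‖ψ x‖ * ∫ y, radialWeight y ≤
      ε * (∫ y, radialWeight y) + (∫ y, ‖ψ y‖ ^ 2) / (4 * ε * r ^ 3) := by
  -- The cutoff gives a globally `C²` function without changing `ψ` on the closed ball of radius
  -- `r`, the only region the weight sees.
  let χ : ContDiffBump x := ⟨r, 3 / 2 * r, hr, by linarith⟩
  let u : R3 → ℂ := fun y => χ y • ψ y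
  have hu : ContDiff ℝ 2 u := by
    refine contDiff_iff_contDiffAt.2 fun y => ?_
    by_cases hy : y ∈ Metric.ball x (2 * r)
    · exact χ.contDiffAt.smul (hdiff.contDiffAt (Metric.isOpen_ball.mem_nhds hy))
    · have hnot : y ∉ tsupport χ := by
        rw [χ.tsupport_eq]
        simp only [Metric.mem_ball, Metric.mem_closedBall, not_lt, not_le] at hy ⊢
        change 3 / 2 * r < dist y x
        linarith
      have hev : u =ᶠ[𝓝 y] fun _ => 0 := by
        filter_upwards [(notMem_tsupport_iff_eventuallyEq.1 hnot)] with w hw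
        simp [u, hw]
      exact contDiffAt_const.congr_of_eventuallyEq hev
  have huψ : ∀ y ∈ Metric.closedBall x r, u y = ψ y := by
    intro y hy
    simp [u, χ.one_of_mem_closedBall hy]
  have hu_harm : ∀ y ∈ Metric.ball x r, Laplacian.laplacian u y = 0 := by
    intro y hy
    have hev : u =ᶠ[𝓝 y] ψ := by
      filter_upwards [Metric.isOpen_ball.mem_nhds hy] with w hw
      exact huψ w (Metric.ball_subset_closedBall hw)
    rw [(InnerProductSpace.laplacian_congr_nhds hev).eq_of_nhds]
    exact hharm y (Metric.ball_subset_ball (by linarith) hy)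
  have hmean := integral_radialWeight_eq hu hr.le hu_harm
  rw [huψ x (by simp [hr.le])] at hmean
  have hsq : Integrable fun y => ‖ψ y‖ ^ 2 :=
    (memLp_two_iff_integrable_sq_norm hψ.aestronglyMeasurable).1 hψ
  have hsq' : Integrable fun y => ‖ψ (x + r • y)‖ ^ 2 :=
    (hsq.comp_add_left x).comp_smul hr.ne'
  have hscale : ∫ y, ‖ψ (x + r • y)‖ ^ 2 = (r ^ 3)⁻¹ * ∫ y, ‖ψ y‖ ^ 2 := by
    rw [Measure.integral_comp_smul volume (fun y => ‖ψ (x + y)‖ ^ 2) r,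
      integral_add_left_eq_self (fun y => ‖ψ y‖ ^ 2) x]
    simp [abs_of_pos hr]
  have hle : ‖∫ y, radialWeight y • u (x + r • y)‖ ≤
      ∫ y, (radialWeight y * ε + ‖ψ (x + r • y)‖ ^ 2 * (4 * ε)⁻¹) := by
    refine norm_integral_le_of_norm_le
      ((integrable_radialWeight.mul_const ε).add (hsq'.mul_const _))
      (Eventually.of_forall fun y => ?_)
    rw [norm_smul, Real.norm_of_nonneg (radialWeight_nonneg y)]
    rcases le_or_gt 1 ‖y‖ with hy | hy
    · rw [radialWeight_eq_zero hy]
      simp only [zero_mul, zero_add]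
      positivity
    · rw [huψ]
      · set t := ‖ψ (x + r • y)‖
        have h1 : t ≤ ε + t ^ 2 * (4 * ε)⁻¹ := by
          rw [← sub_nonneg]
          have : ε + t ^ 2 * (4 * ε)⁻¹ - t = (t - 2 * ε) ^ 2 * (4 * ε)⁻¹ := by
            field_simp
            ring
          rw [this]
          positivity
        have h2 : 0 ≤ t ^ 2 * (4 * ε)⁻¹ := by positivity
        nlinarith [radialWeight_nonneg y, radialWeight_le_one y]
      · rw [mem_closedBall_iff_norm, add_sub_cancel_left, norm_smul, Real.norm_of_nonneg hr.le]
        nlinarith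
  rw [hmean, integral_add (integrable_radialWeight.mul_const ε) (hsq'.mul_const _),
    integral_mul_const, integral_mul_const, hscale, norm_smul,
    Real.norm_of_nonneg integral_radialWeight_pos.le] at hle
  calc _ = (∫ y, radialWeight y) * ‖ψ x‖ := mul_comm _ _
    _ ≤ _ := hle
    _ = _ := by
      field_simp

/-- A square-integrable function that is harmonic off finitely many points is `o(1 / |x|)`. -/
theorem tendsto_norm_mul_norm_of_memLp {n : ℕ} (z : Fin n → R3) {ψ : R3 → ℂ}
    (hψ : MemLp ψ 2 volume) (hdiff : ContDiffOn ℝ 2 ψ (Set.range z)ᶜ)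
    (hharm : ∀ x ∉ Set.range z, Laplacian.laplacian ψ x = 0) :
    Tendsto (fun x => ‖x‖ * ‖ψ x‖) (cocompact R3) (𝓝 0) := by
  set I := ∫ y, radialWeight y with hI
  set S := ∫ y, ‖ψ y‖ ^ 2 with hS
  have hIpos : 0 < I := integral_radialWeight_pos
  have hSnn : 0 ≤ S := integral_nonneg fun y => by positivity
  have hnorm : Tendsto (fun x : R3 => ‖x‖) (cocompact R3) atTop := tendsto_norm_cocompact_atTop
  obtain ⟨M, hM⟩ := (Set.finite_range z).isBounded.exists_norm_le
  rw [Metric.tendsto_nhds]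
  intro δ hδ
  filter_upwards [hnorm.eventually_gt_atTop 0, hnorm.eventually_gt_atTop (2 * M),
    hnorm.eventually_gt_atTop (64 * S / (δ ^ 2 * I))] with x hx0 hxM hxS
  -- The doubled ball has radius `‖x‖ / 2`, so it misses every `z j` once `‖x‖ > 2 * M`.
  have hr : 0 < ‖x‖ / 4 := by positivity
  have hsub : Metric.ball x (2 * (‖x‖ / 4)) ⊆ (Set.range z)ᶜ := by
    intro y hy hyz
    have h1 := hM y hyz
    rw [mem_ball_iff_norm, norm_sub_rev] at hy
    have := norm_sub_norm_le x y
    linarith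
  -- After multiplication by `‖x‖`, this `ε` turns the first term into `δ / 2 * I`, while the second
  -- still decays like `1 / ‖x‖`.
  have hb := norm_mul_integral_radialWeight_le hψ hr (ε := δ / (2 * ‖x‖)) (by positivity)
    (hdiff.mono hsub) fun y hy => hharm y (hsub hy)
  rw [← hI, ← hS] at hb
  rw [dist_zero_right, Real.norm_of_nonneg (by positivity)]
  have h1 : ‖x‖ * (‖ψ x‖ * I) ≤ δ / 2 * I + 32 * S / (δ * ‖x‖) := by
    calc _ ≤ ‖x‖ * (δ / (2 * ‖x‖) * I + S / (4 * (δ / (2 * ‖x‖)) * (‖x‖ / 4) ^ 3)) := by gcongr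
      _ = _ := by
        field_simp
        ring
  have h2 : 32 * S / (δ * ‖x‖) < δ / 2 * I := by
    rw [div_lt_iff₀ (by positivity)] at hxS ⊢
    nlinarith
  have h3 : (‖x‖ * ‖ψ x‖) * I < δ * I := by linarith
  exact lt_of_mul_lt_mul_right h3 hIpos.le

/-! ### Maximum principle with removable singularities -/

open InnerProductSpace

theorem harmonicAt_inv_norm_sub {x z : R3} (hx : x ≠ z) :
    HarmonicAt (fun y : R3 => ‖y - z‖⁻¹) x := by
  constructor
  · exact ContDiffAt.comp (g := fun y : R3 => ‖y‖⁻¹) x (contDiffAt_inv_norm (sub_ne_zero.2 hx))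
      (by fun_prop)
  · filter_upwards [isOpen_ne.mem_nhds hx] with y hy
    rw [laplacian_comp_sub (fun y : R3 => ‖y‖⁻¹), laplacian_inv_norm (sub_ne_zero.2 hy)]
    rfl

theorem harmonicAt_finset_sum {ι E F : Type*} [NormedAddCommGroup E] [InnerProductSpace ℝ E]
    [FiniteDimensional ℝ E] [NormedAddCommGroup F] [NormedSpace ℝ F] {x : E} (s : Finset ι)
    {f : ι → E → F} (h : ∀ i ∈ s, HarmonicAt (f i) x) :
    HarmonicAt (fun y => ∑ i ∈ s, f i y) x := by
  classical
  induction s using Finset.induction_on with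
  | empty => simp
  | insert a s ha ih =>
    simp only [Finset.sum_insert ha]
    exact (h a (Finset.mem_insert_self a s)).add
      (ih fun i hi => h i (Finset.mem_insert_of_mem hi))

/-- Maximum principle on the complement of finitely many points, for functions that are bounded
above near these points and vanish at infinity. -/
theorem nonpos_of_harmonicAt_compl_range {n : ℕ} (z : Fin n → R3) {u : R3 → ℝ}
    (hharm : ∀ x ∉ Set.range z, HarmonicAt u x)
    (hbdd : ∀ j, ∃ C, ∀ᶠ x in 𝓝[≠] (z j), u x ≤ C)
    (hlim : Tendsto u (cocompact R3) (𝓝 0)) {x₀ : R3} (hx₀ : x₀ ∉ Set.range z) : u x₀ ≤ 0 := by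
  by_contra! hpos
  set m := u x₀ / 3 with hm
  have hmpos : 0 < m := by positivity
  let Φ : R3 → ℝ := fun x => ∑ j, ‖x - z j‖⁻¹
  have hΦnn : ∀ x, 0 ≤ Φ x := fun x => Finset.sum_nonneg fun j _ => by positivity
  have hΦharm : ∀ x ∉ Set.range z, HarmonicAt Φ x := fun x hx =>
    harmonicAt_finset_sum _ fun j _ => harmonicAt_inv_norm_sub fun h => hx ⟨j, h.symm⟩
  -- Small enough to cost at most `m` out of `u x₀ = 3 * m`, yet any positive multiple of `Φ`
  -- outweighs the upper bound on `u` near the poles.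
  set δ := m / (Φ x₀ + 1) with hδ
  have hδpos : 0 < δ := div_pos hmpos (by linarith [hΦnn x₀])
  have hδΦ : δ * Φ x₀ ≤ m := by
    rw [hδ, div_mul_eq_mul_div, div_le_iff₀ (by linarith [hΦnn x₀])]
    nlinarith
  let v : R3 → ℝ := u - δ • Φ
  have hv : ∀ x, v x = u x - δ * Φ x := fun x => rfl
  have hvharm : ∀ x ∉ Set.range z, HarmonicAt v x := fun x hx =>
    (hharm x hx).sub (hΦharm x hx).const_smul
  obtain ⟨ρ, hρ⟩ : ∃ ρ : ℝ, ∀ x : R3, ρ ≤ ‖x‖ → u x < m := by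
    obtain ⟨K, hK, hKu⟩ := mem_cocompact.1 (hlim.eventually (eventually_lt_nhds hmpos))
    obtain ⟨ρ, hρ⟩ := hK.isBounded.exists_norm_le
    refine ⟨ρ + 1, fun x hx => hKu fun hxK => ?_⟩
    linarith [hρ x hxK]
  have hinner : ∀ j, ∃ s > 0, ∀ x, x ≠ z j → ‖x - z j‖ < 2 * s → v x < 0 := by
    intro j
    obtain ⟨C, hC⟩ := hbdd j
    have hinv : Tendsto (fun x : R3 => ‖x - z j‖⁻¹) (𝓝[≠] (z j)) atTop :=
      tendsto_inv_nhdsGT_zero.comp (tendsto_norm_sub_self_nhdsNE (z j))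
    have hev : ∀ᶠ x in 𝓝[≠] (z j), v x < 0 := by
      filter_upwards [hC, hinv.eventually_gt_atTop (C / δ)] with x h1 h2
      have h3 : ‖x - z j‖⁻¹ ≤ Φ x :=
        Finset.single_le_sum (f := fun i => ‖x - z i‖⁻¹) (fun i _ => by positivity)
          (Finset.mem_univ j)
      rw [div_lt_iff₀ hδpos] at h2
      rw [hv]
      nlinarith
    rw [eventually_nhdsWithin_iff, Metric.eventually_nhds_iff] at hev
    obtain ⟨s, hs, h⟩ := hev
    -- Halving leaves room for `v < 0` on the punctured closed ball of radius `s j`, so the maximum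
    -- found below cannot lie on its boundary.
    refine ⟨s / 2, half_pos hs, fun x hx hxs => h ?_ hx⟩
    rw [dist_eq_norm]
    linarith
  choose s hs hsv using hinner
  -- The term `η ‖x‖²` makes the Laplacian of `f` equal to `6 * η > 0`, but stays below `m` on the
  -- ball of radius `ρ`. A maximum of `f` thus still has `v > m`, which puts it in the interior of
  -- `t`.
  set η := m / (2 * (ρ ^ 2 + 1)) with hη
  have hηpos : 0 < η := by positivity
  have hηρ : η * ρ ^ 2 < m := by
    rw [hη, div_mul_eq_mul_div, div_lt_iff₀ (by positivity)]
    nlinarith [sq_nonneg ρ]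
  let f : R3 → ℝ := v + η • fun x => ‖x‖ ^ 2
  have hf : ∀ x, f x = v x + η * ‖x‖ ^ 2 := fun x => rfl
  have hfdiff : ∀ x ∉ Set.range z, ContDiffAt ℝ 2 f x := fun x hx =>
    (hvharm x hx).1.add ((contDiff_norm_sq ℝ).contDiffAt.const_smul η)
  let t : Set R3 := Metric.closedBall 0 ρ ∩ ⋂ j, (Metric.ball (z j) (s j))ᶜ
  have htz : ∀ x ∈ t, x ∉ Set.range z := by
    rintro x ⟨_, hx⟩ ⟨j, rfl⟩
    exact Set.mem_iInter.1 hx j (Metric.mem_ball_self (hs j))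
  have htc : IsCompact t := (isCompact_closedBall _ _).inter_right
    (isClosed_iInter fun j => Metric.isOpen_ball.isClosed_compl)
  have hx₀pos : 2 * m ≤ v x₀ := by
    rw [hv]
    linarith
  have hx₀t : x₀ ∈ t := by
    refine ⟨?_, Set.mem_iInter.2 fun j hj => ?_⟩
    · rw [mem_closedBall_zero_iff]
      by_contra! h
      linarith [hρ x₀ h.le]
    · rw [mem_ball_iff_norm] at hj
      have := hsv j x₀ (fun h => hx₀ ⟨j, h.symm⟩) (by linarith [hs j])
      linarith
  obtain ⟨x₁, hx₁t, hmax⟩ := htc.exists_isMaxOn ⟨x₀, hx₀t⟩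
    (fun x hx => (hfdiff x (htz x hx)).continuousAt.continuousWithinAt)
  have hx₁ : 2 * m ≤ f x₁ := by
    have : f x₀ ≤ f x₁ := hmax hx₀t
    rw [hf x₀] at this
    nlinarith [sq_nonneg ‖x₀‖]
  have hx₁ρ : ‖x₁‖ ≤ ρ := by simpa using hx₁t.1
  have hx₁v : m < v x₁ := by
    rw [hf] at hx₁
    have : η * ‖x₁‖ ^ 2 ≤ η * ρ ^ 2 := by gcongr
    linarith
  have htnhds : t ∈ 𝓝 x₁ := by
    refine inter_mem ?_ (iInter_mem.2 fun j => ?_)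
    · refine mem_of_superset (Metric.isOpen_ball.mem_nhds ?_) Metric.ball_subset_closedBall
      rw [mem_ball_zero_iff]
      refine lt_of_not_ge fun h => ?_
      have h1 := hρ x₁ h
      have h2 := hv x₁
      nlinarith [hΦnn x₁]
    · have hnot : x₁ ∈ (Metric.closedBall (z j) (s j))ᶜ := by
        intro h
        rw [mem_closedBall_iff_norm] at h
        have := hsv j x₁ (fun h => htz x₁ hx₁t ⟨j, h.symm⟩) (by linarith [hs j])
        linarith
      exact mem_of_superset (Metric.isClosed_closedBall.isOpen_compl.mem_nhds hnot)
        (Set.compl_subset_compl.2 Metric.ball_subset_closedBall)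
  have hlap := laplacian_nonpos_of_isLocalMax (hfdiff x₁ (htz x₁ hx₁t)) (hmax.isLocalMax htnhds)
  have hv₁ := hvharm x₁ (htz x₁ hx₁t)
  have hsum : Laplacian.laplacian f x₁ =
      Laplacian.laplacian v x₁ + Laplacian.laplacian (η • fun x : R3 => ‖x‖ ^ 2) x₁ :=
    hv₁.1.laplacian_add ((contDiff_norm_sq ℝ).contDiffAt.const_smul η)
  rw [hsum, laplacian_smul η (contDiff_norm_sq ℝ).contDiffAt, hv₁.2.eq_of_nhds,
    laplacian_norm_sq] at hlap
  simp at hlap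
  linarith

/-- Bounded singularities at finitely many points are removable: a complex harmonic function
with such singularities that vanishes at infinity is zero. -/
theorem eq_zero_of_harmonicAt_compl_range {n : ℕ} (z : Fin n → R3) {φ : R3 → ℂ}
    (hharm : ∀ x ∉ Set.range z, HarmonicAt φ x)
    (hbdd : ∀ j, ∃ C, ∀ᶠ x in 𝓝[≠] (z j), ‖φ x‖ ≤ C)
    (hlim : Tendsto φ (cocompact R3) (𝓝 0)) {x : R3} (hx : x ∉ Set.range z) : φ x = 0 := by
  -- The one-sided bound for every real functional, applied to `l` and `-l`, gives equality.
  have key : ∀ l : ℂ →L[ℝ] ℝ, l (φ x) ≤ 0 := by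
    intro l
    refine nonpos_of_harmonicAt_compl_range z (u := l ∘ φ)
      (fun y hy => (hharm y hy).comp_CLM l) (fun j => ?_) ?_ hx
    · obtain ⟨C, hC⟩ := hbdd j
      refine ⟨‖l‖ * C, hC.mono fun y hy => ?_⟩
      calc l (φ y) ≤ ‖l (φ y)‖ := Real.le_norm_self _
        _ ≤ ‖l‖ * ‖φ y‖ := l.le_opNorm _
        _ ≤ ‖l‖ * C := by gcongr
    · simpa using (l.continuous.tendsto 0).comp hlim
  have key' : ∀ l : ℂ →L[ℝ] ℝ, l (φ x) = 0 := fun l =>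
    le_antisymm (key l) (by simpa using key (-l))
  exact Complex.ext (key' Complex.reCLM) (key' Complex.imCLM)

/-! ### Coulomb sums near the scatterers -/

/-- The part of `coulombSum z q` that is regular at `z j`. -/
def coulombRegular {n : ℕ} (z : Fin n → R3) (q : Fin n → ℂ) (j : Fin n) (x : R3) : ℂ :=
  ∑ i ∈ Finset.univ.erase j, -(1 / (4 * (Real.pi : ℂ))) * q i * ((‖x - z i‖⁻¹ : ℝ) : ℂ)

theorem coulombSum_eq_sum {n : ℕ} (z : Fin n → R3) (q : Fin n → ℂ) (x : R3) :
    coulombSum z q x =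
      ∑ i, -(1 / (4 * (Real.pi : ℂ))) * q i * ((‖x - z i‖⁻¹ : ℝ) : ℂ) := by
  rw [coulombSum, Finset.mul_sum]
  refine Finset.sum_congr rfl fun i _ => ?_
  push_cast
  ring

theorem coulombSum_eq_add_regular {n : ℕ} (z : Fin n → R3) (q : Fin n → ℂ) (j : Fin n) (x : R3) :
    coulombSum z q x =
      -(1 / (4 * (Real.pi : ℂ))) * q j / (‖x - z j‖ : ℂ) + coulombRegular z q j x := by
  rw [coulombSum_eq_sum, coulombRegular, ← Finset.add_sum_erase _ _ (Finset.mem_univ j)]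
  push_cast
  rfl

theorem harmonicAt_mul_inv_norm_sub (c : ℂ) {x z : R3} (hx : x ≠ z) :
    HarmonicAt (fun y : R3 => c * ((‖y - z‖⁻¹ : ℝ) : ℂ)) x := by
  have h := (harmonicAt_inv_norm_sub hx).comp_CLM ((ContinuousLinearMap.id ℝ ℝ).smulRight c)
  convert h using 1
  ext y
  simp [mul_comm]

theorem harmonicAt_coulombSum {n : ℕ} (z : Fin n → R3) (q : Fin n → ℂ) {x : R3}
    (hx : x ∉ Set.range z) : HarmonicAt (coulombSum z q) x := by
  rw [funext (coulombSum_eq_sum z q)]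
  exact harmonicAt_finset_sum _ fun i _ =>
    harmonicAt_mul_inv_norm_sub _ fun h => hx ⟨i, h.symm⟩

theorem coulombRegular_sub_isBigO {n : ℕ} {z : Fin n → R3} (hz : Function.Injective z)
    (q : Fin n → ℂ) (j : Fin n) :
    (fun x => coulombRegular z q j x - coulombRegular z q j (z j)) =O[𝓝[≠] (z j)]
      fun x => ‖x - z j‖ := by
  have hharm : HarmonicAt (coulombRegular z q j) (z j) :=
    harmonicAt_finset_sum _ fun i hi =>
      harmonicAt_mul_inv_norm_sub _ fun h => (Finset.ne_of_mem_erase hi) (hz h).symm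
  exact ((hharm.1.differentiableAt (by simp)).isBigO_sub.mono nhdsWithin_le_nhds).norm_right

/-- The link between the linear algebra and the point conditions: at `E = 0` the off-diagonal
entries are precisely the Coulomb potentials of the other charges at `z j`. -/
theorem scattererMatrix_zero_mulVec {n : ℕ} (z : Fin n → R3) (α : Fin n → ℝ) (q : Fin n → ℂ)
    (j : Fin n) :
    (scattererMatrix z α 0).mulVec q j = α j * q j + coulombRegular z q j (z j) := by
  have hs : sqrtE 0 = 0 := by simp [sqrtE]
  simp only [Matrix.mulVec, dotProduct]
  rw [← Finset.add_sum_erase _ _ (Finset.mem_univ j), coulombRegular]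
  congr 1
  · simp [scattererMatrix, hs]
  · refine Finset.sum_congr rfl fun i hi => ?_
    simp [scattererMatrix, Finset.ne_of_mem_erase hi, greenPlus, hs]
    ring

theorem tendsto_norm_sub_zero (z : R3) :
    Tendsto (fun x : R3 => (‖x - z‖ : ℂ)) (𝓝[≠] z) (𝓝 0) := by
  have h : Continuous fun x : R3 => (‖x - z‖ : ℂ) := by fun_prop
  simpa using (h.tendsto z).mono_left nhdsWithin_le_nhds

/-- Coefficients of a singular expansion are unique: multiplying by `‖x - z‖` and passing to the
limit isolates `a`, after which `b` is itself the limit. -/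
theorem eq_zero_of_isBigO_norm_sub {z : R3} {a b : ℂ}
    (h : (fun x : R3 => a / (‖x - z‖ : ℂ) + b) =O[𝓝[≠] z] fun x => ‖x - z‖) :
    a = 0 ∧ b = 0 := by
  have hr := tendsto_norm_sub_zero z
  have hr' : Tendsto (fun x : R3 => ‖x - z‖) (𝓝[≠] z) (𝓝 0) :=
    (tendsto_norm_sub_self_nhdsNE z).mono_right nhdsWithin_le_nhds
  have h0 : Tendsto (fun x : R3 => a / (‖x - z‖ : ℂ) + b) (𝓝[≠] z) (𝓝 0) := h.trans_tendsto hr'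
  have ha : a = 0 := by
    have h1 : Tendsto (fun x : R3 => a + b * (‖x - z‖ : ℂ)) (𝓝[≠] z) (𝓝 (0 * 0)) := by
      refine (h0.mul hr).congr' ?_
      filter_upwards [self_mem_nhdsWithin] with x hx
      have : (‖x - z‖ : ℂ) ≠ 0 := by
        simpa [sub_eq_zero] using hx
      field_simp
    have h2 : Tendsto (fun x : R3 => a + b * (‖x - z‖ : ℂ)) (𝓝[≠] z) (𝓝 (a + b * 0)) :=
      (hr.const_mul b).const_add a
    simpa using tendsto_nhds_unique h2 h1
  refine ⟨ha, ?_⟩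
  simp only [ha, zero_div, zero_add] at h0
  exact tendsto_nhds_unique tendsto_const_nhds h0

theorem neg_one_div_four_pi_ne_zero : -(1 / (4 * (Real.pi : ℂ))) ≠ 0 := by
  simp

theorem eventually_notMem_range {n : ℕ} (z : Fin n → R3) (j : Fin n) :
    ∀ᶠ x in 𝓝[≠] (z j), x ∉ Set.range z := by
  have hfin : ((Set.range z) \ {z j}).Finite := (Set.finite_range z).subset Set.sdiff_subset
  rw [eventually_nhdsWithin_iff]
  filter_upwards [hfin.isClosed.isOpen_compl.mem_nhds (x := z j) (by simp)] with x hx hxj hxz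
  exact hx ⟨hxz, hxj⟩

theorem coulombSum_injective {n : ℕ} {z : Fin n → R3} (hz : Function.Injective z)
    {q q' : Fin n → ℂ} (h : ∀ x ∉ Set.range z, coulombSum z q x = coulombSum z q' x) :
    q = q' := by
  ext j
  have hO := (coulombRegular_sub_isBigO hz q' j).sub (coulombRegular_sub_isBigO hz q j)
  have := eq_zero_of_isBigO_norm_sub (z := z j)
    (a := -(1 / (4 * (Real.pi : ℂ))) * (q j - q' j))
    (b := coulombRegular z q j (z j) - coulombRegular z q' j (z j)) ?_
  · exact sub_eq_zero.1 ((mul_eq_zero.1 this.1).resolve_left neg_one_div_four_pi_ne_zero)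
  · refine hO.congr' ?_ EventuallyEq.rfl
    filter_upwards [eventually_notMem_range z j] with x hx
    have := h x hx
    rw [coulombSum_eq_add_regular z q j, coulombSum_eq_add_regular z q' j] at this
    rw [mul_sub, sub_div]
    linear_combination -this

/-! ### Coulomb sums at infinity and square integrability -/

theorem tendsto_norm_mul_coulombSum {n : ℕ} (z : Fin n → R3) (q : Fin n → ℂ) :
    Tendsto (fun x => (‖x‖ : ℂ) * coulombSum z q x) (cocompact R3)
      (𝓝 (-(1 / (4 * (Real.pi : ℂ))) * ∑ j, q j)) := by
  have hnorm : Tendsto (fun x : R3 => ‖x‖) (cocompact R3) atTop := tendsto_norm_cocompact_atTop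
  have hterm : ∀ w : R3, Tendsto (fun x : R3 => ‖x‖ * ‖x - w‖⁻¹) (cocompact R3) (𝓝 1) := by
    intro w
    have hinv : Tendsto (fun x : R3 => 2 * ‖w‖ * ‖x‖⁻¹) (cocompact R3) (𝓝 0) := by
      simpa using (tendsto_inv_atTop_zero.comp hnorm).const_mul (2 * ‖w‖)
    rw [tendsto_iff_norm_sub_tendsto_zero]
    refine squeeze_zero' (Eventually.of_forall fun x => norm_nonneg _) ?_ hinv
    filter_upwards [hnorm.eventually_gt_atTop (2 * ‖w‖), hnorm.eventually_gt_atTop 0] with x hx h0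
    have h1 : ‖x‖ - ‖w‖ ≤ ‖x - w‖ := norm_sub_norm_le x w
    have hpos : 0 < ‖x - w‖ := by linarith
    have h2 : ‖x‖ * ‖x - w‖⁻¹ - 1 = (‖x‖ - ‖x - w‖) * ‖x - w‖⁻¹ := by field_simp
    have h3 : ‖‖x‖ - ‖x - w‖‖ ≤ ‖w‖ := by
      simpa using abs_norm_sub_norm_le x (x - w)
    have h4 : ‖x - w‖⁻¹ ≤ 2 * ‖x‖⁻¹ := by
      rw [← div_eq_mul_inv, inv_eq_one_div, div_le_div_iff₀ hpos h0]
      linarith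
    rw [h2, norm_mul, norm_inv, norm_norm]
    calc _ ≤ ‖w‖ * (2 * ‖x‖⁻¹) := by gcongr
      _ = _ := by ring
  rw [Finset.mul_sum]
  have hsum : Tendsto (fun x : R3 => ∑ j, -(1 / (4 * (Real.pi : ℂ))) * q j *
      ((‖x‖ * ‖x - z j‖⁻¹ : ℝ) : ℂ)) (cocompact R3)
      (𝓝 (∑ j, -(1 / (4 * (Real.pi : ℂ))) * q j * ((1 : ℝ) : ℂ))) :=
    tendsto_finsetSum _ fun j _ =>
      ((Complex.continuous_ofReal.tendsto 1).comp (hterm (z j))).const_mul _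
  simp only [Complex.ofReal_one, mul_one] at hsum
  refine hsum.congr fun x => ?_
  rw [coulombSum_eq_sum, Finset.mul_sum]
  refine Finset.sum_congr rfl fun j _ => ?_
  push_cast
  ring

theorem tendsto_coulombSum {n : ℕ} (z : Fin n → R3) (q : Fin n → ℂ) :
    Tendsto (coulombSum z q) (cocompact R3) (𝓝 0) := by
  have hnorm : Tendsto (fun x : R3 => ‖x‖) (cocompact R3) atTop := tendsto_norm_cocompact_atTop
  have hinv : Tendsto (fun x : R3 => ((‖x‖⁻¹ : ℝ) : ℂ)) (cocompact R3) (𝓝 0) := by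
    simpa [Function.comp_def] using
      (Complex.continuous_ofReal.tendsto 0).comp (tendsto_inv_atTop_zero.comp hnorm)
  have h := hinv.mul (tendsto_norm_mul_coulombSum z q)
  rw [zero_mul] at h
  refine h.congr' ?_
  filter_upwards [hnorm.eventually_gt_atTop 0] with x hx
  have : (‖x‖ : ℂ) ≠ 0 := Complex.ofReal_ne_zero.2 hx.ne'
  push_cast
  field_simp

/-- The singularity `|x|⁻²` of the square is integrable at the origin because `2 < 3`. -/
theorem memLp_indicator_inv_norm :
    MemLp ((Metric.ball (0 : R3) 1).indicator fun x => ‖x‖⁻¹) 2 volume := by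
  have hmeas : AEStronglyMeasurable (fun x : R3 => ‖x‖⁻¹) volume :=
    (measurable_norm.inv).aestronglyMeasurable
  rw [memLp_indicator_iff_restrict measurableSet_ball,
    memLp_two_iff_integrable_sq hmeas.restrict]
  refine integrableOn_ball_of_norm_le_rpow (by simp) (C := 1) (α := 2) (by norm_num)
    (Eventually.of_forall fun x => ?_) (hmeas.pow 2)
  rw [Real.rpow_neg (norm_nonneg x)]
  simp

/-- The function `1 / |x|`, cut off near the origin. -/
def farInvNorm : R3 → ℝ := (Metric.ball (0 : R3) 1)ᶜ.indicator fun x => ‖x‖⁻¹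

theorem farInvNorm_of_one_le {x : R3} (hx : 1 ≤ ‖x‖) : farInvNorm x = ‖x‖⁻¹ :=
  Set.indicator_of_mem (by simpa using hx) _

theorem measurable_farInvNorm : Measurable farInvNorm :=
  measurable_norm.inv.indicator measurableSet_ball.compl

theorem farInvNorm_mem_Icc (x : R3) : farInvNorm x ∈ Set.Icc 0 1 := by
  rcases le_or_gt 1 ‖x‖ with hx | hx
  · rw [farInvNorm_of_one_le hx]
    exact ⟨by positivity, inv_le_one_of_one_le₀ hx⟩
  · rw [farInvNorm, Set.indicator_of_notMem (by simpa using hx)]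
    simp

theorem memLp_one_add_norm_sq_inv : MemLp (fun x : R3 => ((1 + ‖x‖) ^ 2)⁻¹) 2 volume := by
  have hcont : Continuous fun x : R3 => ((1 + ‖x‖) ^ 2)⁻¹ :=
    Continuous.inv₀ (by fun_prop) fun x => by positivity
  rw [memLp_two_iff_integrable_sq hcont.aestronglyMeasurable]
  refine (integrable_one_add_norm (E := R3) (r := 4) (by norm_num)).congr
    (Eventually.of_forall fun x => ?_)
  simp only
  rw [Real.rpow_neg (by positivity), inv_pow, ← pow_mul]
  norm_cast

/-- Translation changes `1/|x|` only at order `|x|⁻²`. For `‖x‖ ≥ 2 + 2‖z‖` one has `‖x - z‖ ≥ ‖x‖ /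
2` and `1 + ‖x‖ ≤ 2‖x‖`, which gives `8‖z‖`; for smaller `‖x‖` the difference is at most `1`, which
gives the square. -/
theorem abs_farInvNorm_sub_le (z x : R3) :
    |farInvNorm (x - z) - farInvNorm x| ≤
      ((3 + 2 * ‖z‖) ^ 2 + 8 * ‖z‖) * ((1 + ‖x‖) ^ 2)⁻¹ := by
  rw [← div_eq_mul_inv, le_div_iff₀ (by positivity)]
  rcases le_or_gt (2 + 2 * ‖z‖) ‖x‖ with hx | hx
  · have hz := norm_nonneg z
    have h1 : ‖x‖ - ‖z‖ ≤ ‖x - z‖ := norm_sub_norm_le x z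
    have hx0 : 0 < ‖x‖ := by linarith
    have hxz : 0 < ‖x - z‖ := by linarith
    rw [farInvNorm_of_one_le (by linarith), farInvNorm_of_one_le (by linarith),
      inv_sub_inv hxz.ne' hx0.ne', abs_div, abs_of_pos (mul_pos hxz hx0)]
    have h2 : |‖x‖ - ‖x - z‖| ≤ ‖z‖ := by simpa using abs_norm_sub_norm_le x (x - z)
    rw [div_mul_eq_mul_div, div_le_iff₀ (mul_pos hxz hx0)]
    have h3 : (1 + ‖x‖) ^ 2 ≤ 8 * (‖x - z‖ * ‖x‖) := by nlinarith
    calc |‖x‖ - ‖x - z‖| * (1 + ‖x‖) ^ 2 ≤ ‖z‖ * (8 * (‖x - z‖ * ‖x‖)) := by gcongr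
      _ = 8 * ‖z‖ * (‖x - z‖ * ‖x‖) := by ring
      _ ≤ _ := by
        gcongr
        nlinarith [sq_nonneg (3 + 2 * ‖z‖)]
  · have h1 : |farInvNorm (x - z) - farInvNorm x| ≤ 1 := by
      have ha := farInvNorm_mem_Icc (x - z)
      have hb := farInvNorm_mem_Icc x
      rw [abs_le]
      constructor <;> linarith [ha.1, ha.2, hb.1, hb.2]
    have h2 : (1 + ‖x‖) ^ 2 ≤ (3 + 2 * ‖z‖) ^ 2 :=
      pow_le_pow_left₀ (by positivity) (by linarith) 2
    nlinarith [norm_nonneg z, sq_nonneg (1 + ‖x‖), abs_nonneg (farInvNorm (x - z) - farInvNorm x)]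

theorem memLp_inv_norm_sub_farInvNorm (z : R3) :
    MemLp (fun x : R3 => ‖x - z‖⁻¹ - farInvNorm x) 2 volume := by
  have h1 : MemLp (fun x => (Metric.ball (0 : R3) 1).indicator (fun x => ‖x‖⁻¹) (x - z)) 2
      volume :=
    memLp_indicator_inv_norm.comp_measurePreserving (measurePreserving_sub_right volume z)
  have h2 : MemLp (fun x => farInvNorm (x - z) - farInvNorm x) 2 volume := by
    refine (memLp_one_add_norm_sq_inv.const_mul ((3 + 2 * ‖z‖) ^ 2 + 8 * ‖z‖)).mono'
      ?_ (Eventually.of_forall fun x => abs_farInvNorm_sub_le z x)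
    exact ((measurable_farInvNorm.comp (measurable_id.sub_const z)).sub
      measurable_farInvNorm).aestronglyMeasurable
  refine (h1.add h2).congr_norm ?_ (Eventually.of_forall fun x => ?_)
  · exact ((measurable_id.sub_const z).norm.inv.sub measurable_farInvNorm).aestronglyMeasurable
  · have h3 := congrFun (Set.indicator_self_add_compl (Metric.ball (0 : R3) 1)
      fun x => ‖x‖⁻¹) (x - z)
    simp only [Pi.add_apply] at h3 ⊢
    rw [← h3, farInvNorm, add_sub_assoc]

theorem memLp_coulombSum {n : ℕ} (z : Fin n → R3) {q : Fin n → ℂ} (hq : ∑ j, q j = 0) :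
    MemLp (coulombSum z q) 2 volume := by
  -- Neutrality allows the same function to be subtracted from every term, and each corrected term
  -- is in L² by itself.
  have heq : coulombSum z q = fun x => ∑ j, -(1 / (4 * (Real.pi : ℂ))) * q j *
      ((‖x - z j‖⁻¹ - farInvNorm x : ℝ) : ℂ) := by
    ext x
    simp only [Complex.ofReal_sub, mul_sub, Finset.sum_sub_distrib, ← coulombSum_eq_sum]
    rw [← Finset.sum_mul, ← Finset.mul_sum, hq]
    simp
  rw [heq]
  exact memLp_finsetSum _ fun j _ => ((memLp_inv_norm_sub_farInvNorm (z j)).ofReal).const_mul _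

/-! ### The correspondence between null vectors and bound states -/

theorem volume_range_eq_zero {n : ℕ} (z : Fin n → R3) : volume (Set.range z) = 0 :=
  (Set.finite_range z).measure_zero _

theorem isOpen_compl_range {n : ℕ} (z : Fin n → R3) : IsOpen (Set.range z)ᶜ :=
  (Set.finite_range z).isClosed.isOpen_compl

theorem coulombSum_zero {n : ℕ} (z : Fin n → R3) (x : R3) : coulombSum z 0 x = 0 := by
  simp [coulombSum]

theorem IsSolution.harmonicAt {n : ℕ} {z : Fin n → R3} {α : Fin n → ℝ} {ψ : R3 → ℂ}
    (h : IsSolution z α 0 ψ) {x : R3} (hx : x ∉ Set.range z) : HarmonicAt ψ x := by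
  have hnhds : (Set.range z)ᶜ ∈ 𝓝 x := (isOpen_compl_range z).mem_nhds hx
  refine ⟨h.contDiffOn.contDiffAt hnhds, ?_⟩
  filter_upwards [hnhds] with y hy
  simpa using h.equation y hy

theorem isSolution_coulombSum {n : ℕ} {z : Fin n → R3} (hz : Function.Injective z)
    {α : Fin n → ℝ} {q : Fin n → ℂ} (hq : (scattererMatrix z α 0).mulVec q = 0) :
    IsSolution z α 0 (coulombSum z q) where
  contDiffOn := fun x hx => (harmonicAt_coulombSum z q hx).1.contDiffWithinAt
  equation := fun x hx => by
    rw [(harmonicAt_coulombSum z q hx).2.eq_of_nhds]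
    simp
  expansion := fun j => by
    refine ⟨-(1 / (4 * (Real.pi : ℂ))) * q j, coulombRegular z q j (z j), ?_, ?_⟩
    · refine (coulombRegular_sub_isBigO hz q j).congr_left fun x => ?_
      rw [coulombSum_eq_add_regular z q j]
      ring
    · have h := congrFun hq j
      rw [scattererMatrix_zero_mulVec, Pi.zero_apply] at h
      have hpi : (Real.pi : ℂ) ≠ 0 := Complex.ofReal_ne_zero.2 Real.pi_ne_zero
      field_simp
      linear_combination h

theorem isZeroEnergyBoundState_coulombSum {n : ℕ} {z : Fin n → R3} (hz : Function.Injective z)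
    {α : Fin n → ℝ} {q : Fin n → ℂ} (hq : IsNeutralNullVector z α q) :
    IsZeroEnergyBoundState z α (coulombSum z q) := by
  refine ⟨isSolution_coulombSum hz hq.2.1, memLp_coulombSum z hq.2.2, fun hae => hq.1 ?_⟩
  refine coulombSum_injective hz fun x hx => ?_
  rw [coulombSum_zero]
  -- Continuity off the points upgrades vanishing almost everywhere to vanishing everywhere there.
  have hcont : ContinuousOn (coulombSum z q) (Set.range z)ᶜ := fun y hy =>
    (harmonicAt_coulombSum z q hy).1.continuousAt.continuousWithinAt
  exact Measure.eqOn_open_of_ae_eq (ae_restrict_of_ae hae) (isOpen_compl_range z) hcont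
    continuousOn_const hx

theorem IsSolution.exists_eq_coulombSum {n : ℕ} {z : Fin n → R3} (hz : Function.Injective z)
    {α : Fin n → ℝ} {ψ : R3 → ℂ} (h : IsSolution z α 0 ψ) (hψ : MemLp ψ 2 volume) :
    ∃ q : Fin n → ℂ, (scattererMatrix z α 0).mulVec q = 0 ∧ ∑ j, q j = 0 ∧
      ∀ x ∉ Set.range z, ψ x = coulombSum z q x := by
  choose a b hexp hb using h.expansion
  have hpi : (Real.pi : ℂ) ≠ 0 := Complex.ofReal_ne_zero.2 Real.pi_ne_zero
  let q : Fin n → ℂ := fun j => -(4 * (Real.pi : ℂ)) * a j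
  have hqa : ∀ j, -(1 / (4 * (Real.pi : ℂ))) * q j = a j := fun j => by
    simp only [q]
    field_simp
  have hdecay := tendsto_norm_mul_norm_of_memLp z hψ h.contDiffOn fun x hx =>
    (h.harmonicAt hx).2.eq_of_nhds
  have hnorm : Tendsto (fun x : R3 => ‖x‖) (cocompact R3) atTop := tendsto_norm_cocompact_atTop
  have hψ0 : Tendsto ψ (cocompact R3) (𝓝 0) := by
    rw [tendsto_zero_iff_norm_tendsto_zero]
    refine squeeze_zero' (Eventually.of_forall fun x => norm_nonneg _) ?_ hdecay
    filter_upwards [hnorm.eventually_ge_atTop 1] with x hx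
    exact le_mul_of_one_le_left (norm_nonneg _) hx
  -- With the poles cancelled, `d j` is the limit of `ψ - coulombSum z q` at `z j`; its vanishing is
  -- row `j` of `A q = 0`.
  let d : Fin n → ℂ := fun j => b j - coulombRegular z q j (z j)
  have hφexp : ∀ j, (fun x => (ψ x - coulombSum z q x) - d j) =O[𝓝[≠] (z j)]
      fun x => ‖x - z j‖ := fun j => by
    refine ((hexp j).sub (coulombRegular_sub_isBigO hz q j)).congr_left fun x => ?_
    rw [coulombSum_eq_add_regular z q j, hqa]
    simp only [d]
    ring
  have hr : ∀ j, Tendsto (fun x : R3 => ‖x - z j‖) (𝓝[≠] (z j)) (𝓝 0) := fun j =>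
    (tendsto_norm_sub_self_nhdsNE (z j)).mono_right nhdsWithin_le_nhds
  have heq : ∀ x ∉ Set.range z, ψ x - coulombSum z q x = 0 := fun x hx => by
    refine eq_zero_of_harmonicAt_compl_range z (φ := ψ - coulombSum z q)
      (fun y hy => (h.harmonicAt hy).sub (harmonicAt_coulombSum z q hy)) (fun j => ?_) ?_ hx
    · have h1 : Tendsto (fun x => (ψ x - coulombSum z q x) - d j) (𝓝[≠] (z j)) (𝓝 0) :=
        (hφexp j).trans_tendsto (hr j)
      have h2 := (h1.add_const (d j)).norm
      refine ⟨‖0 + d j‖ + 1, ?_⟩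
      filter_upwards [h2.eventually (eventually_lt_nhds (lt_add_one _))] with y hy
      simpa using hy.le
    · simpa [Pi.sub_def] using hψ0.sub (tendsto_coulombSum z q)
  refine ⟨q, ?_, ?_, fun x hx => sub_eq_zero.1 (heq x hx)⟩
  · ext j
    have hd : d j = 0 := by
      refine (eq_zero_of_isBigO_norm_sub (z := z j) (a := 0) (b := d j) ?_).2
      refine ((hφexp j).neg_left).congr' ?_ EventuallyEq.rfl
      filter_upwards [eventually_notMem_range z j] with x hx
      rw [heq x hx]
      simp
    have hd' : b j = coulombRegular z q j (z j) := sub_eq_zero.1 hd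
    rw [scattererMatrix_zero_mulVec, ← hd', hb j, Pi.zero_apply]
    simp only [q]
    ring
  · have h1 : Tendsto (fun x => (‖x‖ : ℂ) * ψ x) (cocompact R3) (𝓝 0) := by
      rw [tendsto_zero_iff_norm_tendsto_zero]
      simpa using hdecay
    -- The limit of `‖x‖ * ψ x` is computed twice: zero by L² decay, and a nonzero multiple of the
    -- total charge.
    have h2 := (tendsto_norm_mul_coulombSum z q).congr' (f₂ := fun x => (‖x‖ : ℂ) * ψ x) (by
      filter_upwards [(Set.finite_range z).isCompact.compl_mem_cocompact] with x hx
      rw [sub_eq_zero.1 (heq x hx)])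
    exact (mul_eq_zero.1 (tendsto_nhds_unique h2 h1)).resolve_left neg_one_div_four_pi_ne_zero

theorem IsZeroEnergyBoundState.existsUnique {n : ℕ} {z : Fin n → R3} (hz : Function.Injective z)
    {α : Fin n → ℝ} {ψ : R3 → ℂ} (h : IsZeroEnergyBoundState z α ψ) :
    ∃! q : Fin n → ℂ, IsNeutralNullVector z α q ∧ ∀ x ∉ Set.range z, ψ x = coulombSum z q x := by
  obtain ⟨q, hq1, hq2, hq3⟩ := h.1.exists_eq_coulombSum hz h.2.1
  refine ⟨q, ⟨⟨?_, hq1, hq2⟩, hq3⟩, fun q' hq' => coulombSum_injective hz fun x hx => ?_⟩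
  · rintro rfl
    refine h.2.2 ?_
    filter_upwards [measure_eq_zero_iff_ae_notMem.1 (volume_range_eq_zero z)] with x hx
    rw [hq3 x hx, coulombSum_zero, Pi.zero_apply]
  · rw [← hq'.2 x hx, hq3 x hx]

end PointScatterer

end

theorem theorem1 {n : ℕ} (z : Fin n → PointScatterer.R3) (hz : Function.Injective z)
    (α : Fin n → ℝ) :
    ((∃ ψ : PointScatterer.R3 → ℂ, PointScatterer.IsZeroEnergyBoundState z α ψ) ↔
      ∃ q : Fin n → ℂ, PointScatterer.IsNeutralNullVector z α q) ∧
    (∀ q : Fin n → ℂ, PointScatterer.IsNeutralNullVector z α q →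
      PointScatterer.IsZeroEnergyBoundState z α (PointScatterer.coulombSum z q)) ∧
    (∀ ψ : PointScatterer.R3 → ℂ, PointScatterer.IsZeroEnergyBoundState z α ψ →
      ∃! q : Fin n → ℂ, PointScatterer.IsNeutralNullVector z α q ∧
        ∀ x ∉ Set.range z, ψ x = PointScatterer.coulombSum z q x) := by
  refine ⟨⟨?_, ?_⟩, ?_, ?_⟩
  · rintro ⟨ψ, hψ⟩
    obtain ⟨q, hq, _⟩ := hψ.existsUnique hz
    exact ⟨q, hq.1⟩
  · rintro ⟨q, hq⟩
    exact ⟨_, PointScatterer.isZeroEnergyBoundState_coulombSum hz hq⟩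
  · exact fun q hq => PointScatterer.isZeroEnergyBoundState_coulombSum hz hq
  · exact fun ψ hψ => hψ.existsUnique hz
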